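/- A signed graph $G^\pm$ is a finite simple graph each of whose edges is labelled $+$ or $-$. Its signed adjacency matrix has entry $1$ at positive edges, $-1$ at negative edges and $0$ elsewhere; its eigenvalues are $\lambda_1(G^\pm)\ge\lambda_2(G^\pm)\ge\cdots$, and $\mathrm{mult}(\lambda,G^\pm)$ is the number of $i$ with $\lambda_i(G^\pm)=\lambda$. A valid $t$-coloring of $G^\pm$ is a coloring of the vertices with $t$ colors such that the endpoints of every negative edge get distinct colors and the endpoints of every positive edge get the same color; $\chi(G^\pm)$ is the least $t$ for which one exists ($\infty$ if there is none). Induced subgraphs keep the edge signs. For a family $\mathcal H$ of signed graphs, a signed graph is $\mathcal H$-free if it contains no member of $\mathcal H$ as an induced subgraph, and $M_{p,\mathcal H}(\lambda,N)$ is the maximum of $\mathrm{mult}(\lambda,G^\pm)$ over all $\mathcal H$-free signed graphs $G^\pm$ on at most $N$ vertices with $\chi(G^\pm)\le p$ and $\lambda_{p+1}(G^\pm)\le\lambda$ (the last condition being void if $G^\pm$ has at most $p$ vertices). **Theorem.** Let $\mathcal H$ be the family of all signed graphs $H^\pm$ (up to isomorphism) on at most $5$ vertices with $\lambda_1(H^\pm)>\sqrt3$.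 Then $\mathcal H$ is a finite family of signed graphs, each with $\lambda_1(H^\pm)>\sqrt3$, every $\mathcal H$-free signed graph $G^\pm$ with $\chi(G^\pm)\le 3$ satisfies $\mathrm{mult}(\sqrt3,G^\pm)\le \tfrac37|G^\pm|$, where $|G^\pm|$ is its number of vertices, and consequently $$M_{3,\mathcal H}(\sqrt3,N)\le \frac{3N}{7}\qquad\text{for every integer } N\ge 0.$$ -/

import Mathlib

/-- A signed graph on `V`: a simple graph each of whose edges carries a sign, given by its graph of
positive edges and its graph of negative edges (no edge has both signs). -/
@[ext]
structure SignedGraph (V : Type*) where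
  pos : SimpleGraph V
  neg : SimpleGraph V
  disj : Disjoint pos neg

namespace SignedGraph

/-- The signed adjacency matrix: `1` at positive edges, `-1` at negative edges, `0` elsewhere. -/
noncomputable def adjMatrix {V : Type*} (G : SignedGraph V) : Matrix V V ℝ :=
  open Classical in
  Matrix.of fun i j => if G.pos.Adj i j then 1 else if G.neg.Adj i j then -1 else 0

theorem isHermitian_adjMatrix {V : Type*} (G : SignedGraph V) : G.adjMatrix.IsHermitian := by
  ext i j
  have hp := G.pos.adj_comm j i
  have hn := G.neg.adj_comm j i
  by_cases h1 : G.pos.Adj i j <;> by_cases h2 : G.neg.Adj i j <;>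
    simp [adjMatrix, hp, hn, h1, h2]

/-- The eigenvalues of the signed adjacency matrix, with multiplicity and in decreasing order.
Indices start at `0`, so `G.eigenvalue ⟨j, _⟩` is the `(j + 1)`-st largest eigenvalue. -/
noncomputable def eigenvalue {V : Type*} [Fintype V] [DecidableEq V] (G : SignedGraph V) :
    Fin (Fintype.card V) → ℝ :=
  G.isHermitian_adjMatrix.eigenvalues₀

/-- The multiplicity of `x` as an eigenvalue of `G`: the number of indices `i` whose eigenvalue
is `x`. -/
noncomputable def mult {V : Type*} [Fintype V] [DecidableEq V] (x : ℝ) (G : SignedGraph V) : ℕ :=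
  Nat.card {i : Fin (Fintype.card V) // G.eigenvalue i = x}

/-- A valid coloring: the endpoints of every negative edge get distinct colors and those of every
positive edge get the same color. -/
def IsValidColoring {V C : Type*} (G : SignedGraph V) (c : V → C) : Prop :=
  (∀ u v, G.neg.Adj u v → c u ≠ c v) ∧ (∀ u v, G.pos.Adj u v → c u = c v)

/-- The least `t` for which `G` has a valid coloring with `t` colors, `⊤` if there is none. -/
noncomputable def chromaticNumber {V : Type*} (G : SignedGraph V) : ℕ∞ :=
  ⨅ t ∈ {t : ℕ | ∃ c : V → Fin t, G.IsValidColoring c}, (t : ℕ∞)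

/-- `H` is (isomorphic to) an induced subgraph of `G`, edge signs being kept. -/
def IsInducedIn {W V : Type*} (H : SignedGraph W) (G : SignedGraph V) : Prop :=
  ∃ f : W ↪ V, ∀ a b,
    (H.pos.Adj a b ↔ G.pos.Adj (f a) (f b)) ∧ (H.neg.Adj a b ↔ G.neg.Adj (f a) (f b))

/-- A family of finite signed graphs; a graph on `n` vertices is given on the vertex set `Fin n`. -/
abbrev Family : Type := Set (Σ n : ℕ, SignedGraph (Fin n))

/-- `G` contains no member of `𝓗` as an induced subgraph. -/
def IsFree {V : Type*} (𝓗 : Family) (G : SignedGraph V) : Prop :=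
  ∀ H ∈ 𝓗, ¬ H.2.IsInducedIn G

/-- The largest eigenvalue of `G` exists (`G` has a vertex) and is greater than `x`. -/
def TopEigenvalueGt {V : Type*} [Fintype V] [DecidableEq V] (G : SignedGraph V) (x : ℝ) : Prop :=
  ∃ h : 0 < Fintype.card V, x < G.eigenvalue ⟨0, h⟩

/-- The `(p + 1)`-st largest eigenvalue of `G` is at most `x`; no condition if `G` has at most `p`
vertices. -/
def EigenvalueSuccLe {V : Type*} [Fintype V] [DecidableEq V] (G : SignedGraph V) (p : ℕ) (x : ℝ) :
    Prop :=
  ∀ h : p < Fintype.card V, G.eigenvalue ⟨p, h⟩ ≤ x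

/-- The multiplicities of `x` in the `𝓗`-free signed graphs on at most `N` vertices with chromatic
number at most `p` and `(p + 1)`-st eigenvalue at most `x`. -/
def multSet (p : ℕ) (𝓗 : Family) (x : ℝ) (N : ℕ) : Set ℕ :=
  {m | ∃ n ≤ N, ∃ G : SignedGraph (Fin n), G.IsFree 𝓗 ∧ G.chromaticNumber ≤ p ∧
    G.EigenvalueSuccLe p x ∧ G.mult x = m}

/-- The maximum of `multSet p 𝓗 x N`. -/
noncomputable def maxMult (p : ℕ) (𝓗 : Family) (x : ℝ) (N : ℕ) : ℕ :=
  sSup (multSet p 𝓗 x N)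

theorem mult_le_card {V : Type*} [Fintype V] [DecidableEq V] (x : ℝ) (G : SignedGraph V) :
    G.mult x ≤ Fintype.card V := by
  unfold mult
  simpa using Nat.card_le_card_of_injective
    (Subtype.val : {i : Fin (Fintype.card V) // G.eigenvalue i = x} → _) Subtype.val_injective

theorem bddAbove_multSet (p : ℕ) (𝓗 : Family) (x : ℝ) (N : ℕ) : BddAbove (multSet p 𝓗 x N) := by
  refine ⟨N, ?_⟩
  rintro m ⟨n, hn, G, -, -, -, rfl⟩
  exact (mult_le_card x G).trans (by simpa using hn)

/-- The supremum in `maxMult` is a genuine maximum. -/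
theorem isGreatest_maxMult (p : ℕ) (𝓗 : Family) (x : ℝ) (N : ℕ) (h : (multSet p 𝓗 x N).Nonempty) :
    IsGreatest (multSet p 𝓗 x N) (maxMult p 𝓗 x N) :=
  ⟨Nat.sSup_mem h (bddAbove_multSet p 𝓗 x N), fun _ hm => le_csSup (bddAbove_multSet p 𝓗 x N) hm⟩

/-- All signed graphs on at most `k` vertices whose largest eigenvalue is greater than `x`. -/
def smallFamily (k : ℕ) (x : ℝ) : Family :=
  {H | H.1 ≤ k ∧ H.2.TopEigenvalueGt x}

end SignedGraph

/-! The signs are read off from a valid colouring `c`, so everything is stated for an uncoloured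
graph `Γ` and its `colorMatrix`. The matrix is rational and `√3` is irrational, so `√3` and `-√3`
have equal multiplicity `m`. This already gives `2m ≤ n`; the gain from `1/2` to `3/7` comes from
local structure, available because freeness bounds the quadratic form by `√3` on any five vertices
(`FormBounded`).

Suppose there is an induced claw. Its largest eigenvalue is exactly `√3`, so each further vertex
must be orthogonal to its Perron vector (`claw_relation`). By irrationality such a vertex misses the
centre, and it meets either no leaf or exactly two, closing a negative 4-cycle. Hence a union of
components around the claw fits into the eight positions of a cube: the centre, three leaves, at
most one further vertex for each pair of leaves, and at most one far vertex. All eight positions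
cannot be filled, since a cube with negative faces has no valid 3-colouring. So this set has `s ≤ 7`
vertices. Either `s = 7` and `2m ≤ 7` gives `m ≤ 3`, or some vertex has degree other than 3, the
square of the matrix is not `3`, and `2m < s`. In both cases `7m ≤ 3s`, and induction handles the
rest of the graph.

Without claws, degrees are at most 4 and every neighbourhood has many edges. Every triangle is
negative, so the trace of the cube is then very negative, and testing the spectrum against `(t +
4)(t - 1)²` gives `5m ≤ 2n`, which is stronger than needed. -/

/-! ### Conjugate roots of rational polynomials -/

open Polynomial in
theorem Polynomial.rootMultiplicity_neg_sqrt_three (p : ℚ[X]) :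
    (p.map (algebraMap ℚ ℝ)).rootMultiplicity (-√3) =
      (p.map (algebraMap ℚ ℝ)).rootMultiplicity (√3) := by
  have hirr : Irrational (√3) := by
    simpa using (Nat.prime_three).irrational_sqrt
  have hsq : (√3 : ℝ) ^ 2 = 3 := Real.sq_sqrt (by norm_num)
  have hne : (√3 : ℝ) ≠ 0 := by positivity
  rcases eq_or_ne p 0 with rfl | hp
  · simp
  have hmonic : (X ^ 2 - C 3 : ℚ[X]).Monic := monic_X_pow_sub_C 3 two_ne_zero
  have hdeg : (X ^ 2 - C 3 : ℚ[X]).degree = 2 := degree_X_pow_sub_C (by norm_num) 3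
  -- Once the full power of `X² - 3` is removed, neither square root of 3 is a root of the cofactor
  -- `q`: the remainder of `q` modulo `X² - 3` is `aX + b` with rational `a`, `b`, and vanishes at
  -- an irrational number only if it is zero.
  obtain ⟨k, q, hq, rfl⟩ := WfDvdMonoid.max_power_factor' hp
    (x := (X ^ 2 - C 3 : ℚ[X])) (by
      intro h
      have := degree_eq_zero_of_isUnit h
      rw [hdeg] at this
      norm_num at this)
  have key : ∀ s : ℝ, s ^ 2 = 3 → Irrational s → (q.map (algebraMap ℚ ℝ)).eval s ≠ 0 := by
    intro s hs hi h0
    apply hq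
    rw [← modByMonic_eq_zero_iff_dvd hmonic]
    have hlt := degree_modByMonic_lt q hmonic
    rw [hdeg] at hlt
    have h1 : (q %ₘ (X ^ 2 - C 3)).degree ≤ 1 := Order.le_of_lt_succ hlt
    have hform := eq_X_add_C_of_degree_le_one h1
    have hev : (((q %ₘ (X ^ 2 - C 3))).map (algebraMap ℚ ℝ)).eval s = 0 := by
      have := congrArg (fun r : ℚ[X] => (r.map (algebraMap ℚ ℝ)).eval s)
        (modByMonic_add_div q (X ^ 2 - C 3))
      simpa [hs, h0] using this
    set a := (q %ₘ (X ^ 2 - C 3)).coeff 1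
    set b := (q %ₘ (X ^ 2 - C 3)).coeff 0
    rw [hform] at hev
    simp at hev
    have ha : a = 0 := by
      by_contra ha
      apply hi
      refine ⟨-b / a, ?_⟩
      have : (a : ℝ) ≠ 0 := by exact_mod_cast ha
      push_cast
      field_simp
      linarith
    have hb : b = 0 := by
      rw [ha] at hev
      simpa using hev
    rw [hform, ha, hb]
    simp
  have hfac : ((X ^ 2 - C 3 : ℚ[X]).map (algebraMap ℚ ℝ)) = (X - C (√3)) * (X - C (-√3)) := by
    have : (C (3 : ℝ)) = C (√3) ^ 2 := by rw [← C_pow, hsq]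
    simp only [Polynomial.map_sub, Polynomial.map_pow, map_X, map_C, C_neg]
    rw [show (algebraMap ℚ ℝ) 3 = 3 by simp, this]
    ring
  have hq0 : (q.map (algebraMap ℚ ℝ)) ≠ 0 := by
    intro h
    exact key _ hsq hirr (by simp [h])
  have hX : ∀ s : ℝ, (X - C s) ≠ 0 := fun s => X_sub_C_ne_zero s
  have e1 := rootMultiplicity_eq_zero (key _ hsq hirr)
  have e2 := rootMultiplicity_eq_zero (key (-√3) (by rw [neg_sq, hsq]) hirr.neg)
  have hs : (√3 : ℝ) ≠ -√3 := by
    intro h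
    apply hne
    linarith
  have hall : ((X - C (√3)) ^ k * (X - C (-√3)) ^ k * q.map (algebraMap ℚ ℝ)) ≠ 0 :=
    mul_ne_zero (mul_ne_zero (pow_ne_zero _ (hX _)) (pow_ne_zero _ (hX _))) hq0
  have hpq := mul_ne_zero (pow_ne_zero k (hX (√3))) (pow_ne_zero k (hX (-√3)))
  rw [Polynomial.map_mul, Polynomial.map_pow, hfac, mul_pow, rootMultiplicity_mul hall,
    rootMultiplicity_mul hall, rootMultiplicity_mul hpq, rootMultiplicity_mul hpq,
    rootMultiplicity_X_sub_C_pow, rootMultiplicity_X_sub_C_pow, e1, e2,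
    rootMultiplicity_eq_zero (p := (X - C (√3)) ^ k) (x := -√3) (by
      simpa only [IsRoot.def, eval_pow, eval_sub, eval_X, eval_C] using
        pow_ne_zero k (sub_ne_zero.2 hs.symm)),
    rootMultiplicity_eq_zero (p := (X - C (-√3)) ^ k) (x := √3) (by
      simpa only [IsRoot.def, eval_pow, eval_sub, eval_X, eval_C] using
        pow_ne_zero k (sub_ne_zero.2 hs))]
  ring

/-! ### Trace and Rayleigh bounds for symmetric matrices -/

namespace Matrix.IsHermitian

variable {V : Type*} [Fintype V] [DecidableEq V] {A : Matrix V V ℝ}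

open Polynomial in
theorem trace_aeval (hA : A.IsHermitian) (p : ℝ[X]) :
    (aeval A p).trace = ∑ i, p.eval (hA.eigenvalues i) := by
  conv_lhs => rw [hA.spectral_theorem]
  have h : aeval (Unitary.conjStarAlgAut ℝ (Matrix V V ℝ) hA.eigenvectorUnitary
      (diagonal (RCLike.ofReal ∘ hA.eigenvalues))) p =
      Unitary.conjStarAlgAut ℝ (Matrix V V ℝ) hA.eigenvectorUnitary
        (aeval (diagonal hA.eigenvalues) p) := by
    exact aeval_algHom_apply (Unitary.conjStarAlgAut ℝ (Matrix V V ℝ)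
      hA.eigenvectorUnitary).toAlgEquiv.toAlgHom _ p
  have hd : aeval (diagonal hA.eigenvalues) p = diagonal (fun i => p.eval (hA.eigenvalues i)) := by
    have := aeval_algHom_apply (Matrix.diagonalAlgHom ℝ (n := V) (α := ℝ)) hA.eigenvalues p
    simp only [Matrix.diagonalAlgHom_apply] at this
    rw [this]
    congr 1
    ext i
    simp [← coe_aeval_eq_eval, Polynomial.aeval_pi]
  rw [h, hd, Unitary.conjStarAlgAut_apply, Matrix.trace_mul_comm, ← mul_assoc]
  simp [Matrix.trace]

theorem card_eigenvalues_eq (hA : A.IsHermitian) (x : ℝ) :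
    (Finset.univ.filter fun i => hA.eigenvalues i = x).card = A.charpoly.rootMultiplicity x := by
  classical
  rw [← Polynomial.count_roots, hA.roots_charpoly_eq_eigenvalues, Multiset.count_map]
  simp [Finset.card, eq_comm]

-- The trace sums `p` over the spectrum; by nonnegativity only the eigenvalues `±√3` need be kept.
-- Each later multiplicity bound is a choice of `p`.
open Polynomial in
theorem rootMultiplicity_mul_le_trace (hA : A.IsHermitian) (p : ℝ[X])
    (hp : ∀ i, 0 ≤ p.eval (hA.eigenvalues i))
    (hconj : A.charpoly.rootMultiplicity (-√3) = A.charpoly.rootMultiplicity (√3)) :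
    (A.charpoly.rootMultiplicity (√3) : ℝ) * (p.eval (√3) + p.eval (-√3)) ≤
      (aeval A p).trace := by
  classical
  rw [hA.trace_aeval]
  have hdis : Disjoint (Finset.univ.filter fun i => hA.eigenvalues i = √3)
      (Finset.univ.filter fun i => hA.eigenvalues i = -√3) := by
    rw [Finset.disjoint_filter]
    intro i _ h1 h2
    have : (0 : ℝ) < √3 := by positivity
    linarith
  calc _ = ∑ i ∈ (Finset.univ.filter fun i => hA.eigenvalues i = √3).disjUnion
            (Finset.univ.filter fun i => hA.eigenvalues i = -√3) hdis,
            p.eval (hA.eigenvalues i) := by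
        rw [Finset.sum_disjUnion, Finset.sum_congr rfl (g := fun _ => p.eval (√3)),
          Finset.sum_congr (s₁ := Finset.univ.filter fun i => hA.eigenvalues i = -√3) rfl
            (g := fun _ => p.eval (-√3)), Finset.sum_const, Finset.sum_const,
          hA.card_eigenvalues_eq, hA.card_eigenvalues_eq, hconj]
        · simp [mul_add]
        · intro i hi
          rw [(Finset.mem_filter.1 hi).2]
        · intro i hi
          rw [(Finset.mem_filter.1 hi).2]
    _ ≤ _ := Finset.sum_le_sum_of_subset_of_nonneg (Finset.subset_univ _) fun i _ _ => hp i

theorem dotProduct_mulVec_le (hA : A.IsHermitian) {x : ℝ} (hx : ∀ i, hA.eigenvalues i ≤ x)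
    (y : V → ℝ) : y ⬝ᵥ A *ᵥ y ≤ x * (y ⬝ᵥ y) := by
  have hps : (x • (1 : Matrix V V ℝ) - A).PosSemidef := by
    have hd : x • (1 : Matrix V V ℝ) - A =
        Unitary.conjStarAlgAut ℝ (Matrix V V ℝ) hA.eigenvectorUnitary (diagonal fun i => x - hA.eigenvalues i) := by
      conv_lhs => rw [hA.spectral_theorem]
      rw [show (diagonal fun i => x - hA.eigenvalues i) = x • (1 : Matrix V V ℝ) -
        diagonal (RCLike.ofReal ∘ hA.eigenvalues) by
          ext i j; by_cases h : i = j <;> simp [h, diagonal]]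
      rw [map_sub, map_smul, map_one]
    rw [hd, Unitary.conjStarAlgAut_apply]
    have := (Matrix.PosSemidef.diagonal (d := fun i => x - hA.eigenvalues i)
      (fun i => by simpa using hx i)).mul_mul_conjTranspose_same
        (hA.eigenvectorUnitary : Matrix V V ℝ)
    simpa [star_eq_conjTranspose] using this
  have := hps.dotProduct_mulVec_nonneg y
  simp [sub_mulVec, smul_mulVec, dotProduct_sub] at this
  linarith

open Polynomial in
/-- If half of the eigenvalues are `√3` and half are `-√3`, the square of the matrix is `3`. -/
theorem two_mul_rootMultiplicity_lt (hA : A.IsHermitian)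
    (hconj : A.charpoly.rootMultiplicity (-√3) = A.charpoly.rootMultiplicity (√3))
    {v : V} (hv : (A * A) v v ≠ 3) :
    2 * A.charpoly.rootMultiplicity (√3) < Fintype.card V := by
  set K : ℝ := ∑ i, (hA.eigenvalues i ^ 2 - 3) ^ 2 with hK
  have hKi : ∀ i, (hA.eigenvalues i ^ 2 - 3) ^ 2 ≤ K := fun i =>
    Finset.single_le_sum (f := fun i => (hA.eigenvalues i ^ 2 - 3) ^ 2)
      (fun i _ => sq_nonneg _) (Finset.mem_univ i)
  have hsq : (√3 : ℝ) ^ 2 = 3 := Real.sq_sqrt (by norm_num)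
  -- The test polynomial equals `K` at `±√3` and its trace is `(n - 1) K`, so strictness reduces to
  -- `K > 0`. Here `K` is the trace of `B Bᵀ` with `B = A² - 3`, and `B v v ≠ 0`.
  have h := hA.rootMultiplicity_mul_le_trace (C K - (X ^ 2 - C 3) ^ 2)
    (fun i => by simpa using hKi i) hconj
  rw [hA.trace_aeval] at h
  have hKpos : 0 < K := by
    have e := hA.trace_aeval ((X ^ 2 - C 3) ^ 2)
    have e2 : ∑ i, ((X ^ 2 - C 3 : ℝ[X]) ^ 2).eval (hA.eigenvalues i) = K := by simp [hK]
    rw [e2] at e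
    rw [← e]
    set B := A * A - algebraMap ℝ (Matrix V V ℝ) 3 with hB
    have hBt : Bᵀ = B := by
      have : Aᵀ = A := by simpa [conjTranspose_eq_transpose_of_trivial] using hA.eq
      simp [hB, transpose_mul, this, algebraMap_eq_diagonal]
    have hval : aeval A ((X ^ 2 - C 3 : ℝ[X]) ^ 2) = B * Bᵀ := by
      rw [hBt]
      simp [hB, pow_two]
    rw [hval]
    have hnn : ∀ i j, 0 ≤ B i j * B i j := fun i j => mul_self_nonneg _
    have hvv : B v v ≠ 0 := by
      simpa [hB, algebraMap_matrix_apply, sub_eq_zero] using hv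
    calc 0 < B v v * B v v := mul_self_pos.2 hvv
      _ ≤ ∑ j, B v j * B v j := Finset.single_le_sum (f := fun j => B v j * B v j)
          (fun j _ => hnn v j) (Finset.mem_univ v)
      _ ≤ ∑ i, ∑ j, B i j * B i j := Finset.single_le_sum (f := fun i => ∑ j, B i j * B i j)
          (fun i _ => Finset.sum_nonneg fun j _ => hnn i j) (Finset.mem_univ v)
      _ = _ := by simp [Matrix.trace, mul_apply]
  simp [hsq] at h
  rw [← hK] at h
  have : (2 * A.charpoly.rootMultiplicity (√3) : ℝ) * K < Fintype.card V * K := by linarith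
  exact_mod_cast lt_of_mul_lt_mul_right this hKpos.le

end Matrix.IsHermitian

/-! ### Coloured graphs: triangles and claws -/

namespace SimpleGraph

variable {V : Type*}

/-- The signed adjacency matrix of a vertex-coloured graph: an edge is positive if its endpoints
have the same colour and negative otherwise. -/
noncomputable def colorMatrix (Γ : SimpleGraph V) (c : V → Fin 3) : Matrix V V ℝ :=
  open Classical in
  Matrix.of fun u v => if Γ.Adj u v then if c u = c v then 1 else -1 else 0

/-- The quadratic form of `Γ.colorMatrix c` is at most `√3` times the squared norm on vectors
supported on at most five vertices. -/
def FormBounded (Γ : SimpleGraph V) (c : V → Fin 3) : Prop :=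
  ∀ k ≤ 5, ∀ f : Fin k → V, Function.Injective f → ∀ x : Fin k → ℝ,
    ∑ i, ∑ j, x i * Γ.colorMatrix c (f i) (f j) * x j ≤ √3 * ∑ i, x i ^ 2

/-- `v` is the centre of an induced claw with leaves `a`, `b`, `d`. -/
structure IsClaw (Γ : SimpleGraph V) (v a b d : V) : Prop where
  va : Γ.Adj v a
  vb : Γ.Adj v b
  vd : Γ.Adj v d
  ab : ¬ Γ.Adj a b
  ad : ¬ Γ.Adj a d
  bd : ¬ Γ.Adj b d
  hab : a ≠ b
  had : a ≠ d
  hbd : b ≠ d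

variable {Γ : SimpleGraph V} {c : V → Fin 3}

theorem colorMatrix_comm (Γ : SimpleGraph V) (c : V → Fin 3) (u v : V) :
    Γ.colorMatrix c u v = Γ.colorMatrix c v u := by
  have h := Γ.adj_comm u v
  by_cases h' : Γ.Adj v u <;> simp [colorMatrix, h, h', eq_comm (a := c u)]

@[simp]
theorem colorMatrix_self (Γ : SimpleGraph V) (c : V → Fin 3) (u : V) :
    Γ.colorMatrix c u u = 0 := by
  simp [colorMatrix]

theorem colorMatrix_of_not_adj {u v : V} (h : ¬ Γ.Adj u v) : Γ.colorMatrix c u v = 0 := by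
  simp [colorMatrix, h]

theorem colorMatrix_of_adj {u v : V} (h : Γ.Adj u v) :
    Γ.colorMatrix c u v = if c u = c v then 1 else -1 := by
  simp [colorMatrix, h]

theorem colorMatrix_mul_self {u v : V} (h : Γ.Adj u v) :
    Γ.colorMatrix c u v * Γ.colorMatrix c u v = 1 := by
  rw [colorMatrix_of_adj h]
  split_ifs <;> norm_num

theorem colorMatrix_ne_zero {u v : V} (h : Γ.Adj u v) : Γ.colorMatrix c u v ≠ 0 := by
  rw [colorMatrix_of_adj h]
  split_ifs <;> norm_num

theorem colorMatrix_eq (Γ : SimpleGraph V) (c : V → Fin 3) (u v : V) :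
    Γ.colorMatrix c u v = 0 ∨ Γ.colorMatrix c u v = 1 ∨ Γ.colorMatrix c u v = -1 := by
  by_cases h : Γ.Adj u v
  · rw [colorMatrix_of_adj h]
    split_ifs <;> simp
  · exact Or.inl (colorMatrix_of_not_adj h)

theorem isHermitian_colorMatrix (Γ : SimpleGraph V) (c : V → Fin 3) :
    (Γ.colorMatrix c).IsHermitian := by
  ext u v
  simpa using Γ.colorMatrix_comm c v u

theorem IsClaw.swap₁₂ {v a b d : V} (h : Γ.IsClaw v a b d) : Γ.IsClaw v b a d :=
  ⟨h.vb, h.va, h.vd, fun e => h.ab e.symm, h.bd, h.ad, h.hab.symm, h.hbd, h.had⟩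

theorem IsClaw.swap₂₃ {v a b d : V} (h : Γ.IsClaw v a b d) : Γ.IsClaw v a d b :=
  ⟨h.va, h.vd, h.vb, h.ad, h.ab, fun e => h.bd e.symm, h.had, h.hab, h.hbd.symm⟩

namespace FormBounded

theorem form_three (hΓ : Γ.FormBounded c) {u v w : V} (huv : u ≠ v) (huw : u ≠ w) (hvw : v ≠ w)
    (x y z : ℝ) :
    2 * (x * y * Γ.colorMatrix c u v + x * z * Γ.colorMatrix c u w +
      y * z * Γ.colorMatrix c v w) ≤ √3 * (x ^ 2 + y ^ 2 + z ^ 2) := by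
  have h := hΓ 3 (by norm_num) ![u, v, w] (by
    intro i j hij
    fin_cases i <;> fin_cases j <;> simp_all) ![x, y, z]
  simp [Fin.sum_univ_three] at h
  rw [Γ.colorMatrix_comm c v u, Γ.colorMatrix_comm c w u, Γ.colorMatrix_comm c w v] at h
  linarith

theorem form_four (hΓ : Γ.FormBounded c) {u v w s : V} (huv : u ≠ v) (huw : u ≠ w) (hus : u ≠ s)
    (hvw : v ≠ w) (hvs : v ≠ s) (hws : w ≠ s) (x y z t : ℝ) :
    2 * (x * y * Γ.colorMatrix c u v + x * z * Γ.colorMatrix c u w + x * t * Γ.colorMatrix c u s +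
      y * z * Γ.colorMatrix c v w + y * t * Γ.colorMatrix c v s + z * t * Γ.colorMatrix c w s) ≤
      √3 * (x ^ 2 + y ^ 2 + z ^ 2 + t ^ 2) := by
  have h := hΓ 4 (by norm_num) ![u, v, w, s] (by
    intro i j hij
    fin_cases i <;> fin_cases j <;> simp_all) ![x, y, z, t]
  simp [Fin.sum_univ_four] at h
  rw [Γ.colorMatrix_comm c v u, Γ.colorMatrix_comm c w u, Γ.colorMatrix_comm c w v,
    Γ.colorMatrix_comm c s u, Γ.colorMatrix_comm c s v, Γ.colorMatrix_comm c s w] at h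
  linarith

theorem form_claw (hΓ : Γ.FormBounded c) {v a b d w : V} (hc : Γ.IsClaw v a b d)
    (hv : w ≠ v) (ha : w ≠ a) (hb : w ≠ b) (hd : w ≠ d) (x y z t r : ℝ) :
    2 * (x * y * Γ.colorMatrix c v a + x * z * Γ.colorMatrix c v b + x * t * Γ.colorMatrix c v d +
      r * (x * Γ.colorMatrix c w v + y * Γ.colorMatrix c w a + z * Γ.colorMatrix c w b +
        t * Γ.colorMatrix c w d)) ≤
      √3 * (x ^ 2 + y ^ 2 + z ^ 2 + t ^ 2 + r ^ 2) := by
  have h1 := hc.va.ne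
  have h2 := hc.vb.ne
  have h3 := hc.vd.ne
  have h4 := hc.hab
  have h5 := hc.had
  have h6 := hc.hbd
  have h := hΓ 5 (by norm_num) ![v, a, b, d, w] (by
    intro i j hij
    fin_cases i <;> fin_cases j <;> simp_all) ![x, y, z, t, r]
  simp [Fin.sum_univ_five] at h
  rw [Γ.colorMatrix_comm c v w, Γ.colorMatrix_comm c a w, Γ.colorMatrix_comm c b w,
    Γ.colorMatrix_comm c d w, Γ.colorMatrix_comm c a v, Γ.colorMatrix_comm c b v,
    Γ.colorMatrix_comm c d v, Γ.colorMatrix_comm c b a, Γ.colorMatrix_comm c d a,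
    Γ.colorMatrix_comm c d b, colorMatrix_of_not_adj hc.ab, colorMatrix_of_not_adj hc.ad,
    colorMatrix_of_not_adj hc.bd] at h
  linarith

theorem sqrt_three_lt_two : (√3 : ℝ) < 2 := by
  rw [Real.sqrt_lt' (by norm_num)]
  norm_num

/-- The vertices of a triangle have distinct colours. -/
theorem color_ne_of_triangle (hΓ : Γ.FormBounded c) {u v w : V} (huv : Γ.Adj u v)
    (huw : Γ.Adj u w) (hvw : Γ.Adj v w) : c u ≠ c v ∧ c u ≠ c w ∧ c v ≠ c w := by
  -- This vector makes both edges at `u` contribute `1` and the third edge contribute the product of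
  -- the three signs. A positive triangle would give `6 ≤ 3√3`, and two equal colours make the
  -- triangle positive.
  have h := hΓ.form_three huv.ne huw.ne hvw.ne 1 (Γ.colorMatrix c u v) (Γ.colorMatrix c u w)
  have hlt := sqrt_three_lt_two
  rw [colorMatrix_of_adj huv, colorMatrix_of_adj huw, colorMatrix_of_adj hvw] at h
  refine ⟨fun e => ?_, fun e => ?_, fun e => ?_⟩
  · by_cases e' : c v = c w <;> simp [e, e'] at h <;> linarith
  · by_cases e' : c w = c v <;> simp [e, e', eq_comm (a := c v) (b := c w)] at h <;> linarith
  · by_cases e' : c u = c w <;> simp [e, e'] at h <;> linarith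

/-- A vertex outside an induced claw is not adjacent to its centre, and is orthogonal to the
Perron vector of the claw. -/
theorem claw_relation (hΓ : Γ.FormBounded c) {v a b d w : V} (hc : Γ.IsClaw v a b d)
    (hv : w ≠ v) (ha : w ≠ a) (hb : w ≠ b) (hd : w ≠ d) :
    ¬ Γ.Adj w v ∧ Γ.colorMatrix c v a * Γ.colorMatrix c w a +
      Γ.colorMatrix c v b * Γ.colorMatrix c w b + Γ.colorMatrix c v d * Γ.colorMatrix c w d = 0 := by
  set L := Γ.colorMatrix c v a * Γ.colorMatrix c w a +
      Γ.colorMatrix c v b * Γ.colorMatrix c w b + Γ.colorMatrix c v d * Γ.colorMatrix c w d with hL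
  have hsq : (√3 : ℝ) * √3 = 3 := Real.mul_self_sqrt (by norm_num)
  have hM : √3 * Γ.colorMatrix c w v + L = 0 := by
    set M := √3 * Γ.colorMatrix c w v + L with hM
    -- The Perron vector of the claw already attains equality, so perturbing it at `w` by `M / 2`,
    -- where `M` is its product with the row of `w`, leaves `M² ≤ √3 M² / 4` and forces `M = 0`.
    have h := hΓ.form_claw hc hv ha hb hd (√3) (Γ.colorMatrix c v a) (Γ.colorMatrix c v b)
      (Γ.colorMatrix c v d) (M / 2)
    have ea := colorMatrix_mul_self (c := c) hc.va
    have eb := colorMatrix_mul_self (c := c) hc.vb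
    have ed := colorMatrix_mul_self (c := c) hc.vd
    have e : √3 * Γ.colorMatrix c w v + Γ.colorMatrix c v a * Γ.colorMatrix c w a +
        Γ.colorMatrix c v b * Γ.colorMatrix c w b +
        Γ.colorMatrix c v d * Γ.colorMatrix c w d = M := by
      rw [hM, hL]
      ring
    rw [e] at h
    have h' : M * M ≤ √3 * (M ^ 2 / 4) := by
      simp only [pow_two, mul_assoc, ea, eb, ed, hsq] at h
      linarith
    have hlt := sqrt_three_lt_two
    nlinarith [sq_nonneg M]
  have hprod : ∀ u, Γ.colorMatrix c v u * Γ.colorMatrix c w u = 0 ∨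
      Γ.colorMatrix c v u * Γ.colorMatrix c w u = 1 ∨
      Γ.colorMatrix c v u * Γ.colorMatrix c w u = -1 := by
    intro u
    rcases Γ.colorMatrix_eq c v u with h | h | h <;>
      rcases Γ.colorMatrix_eq c w u with h' | h' | h' <;> simp [h, h']
  have hw : ¬ Γ.Adj w v := by
    intro hadj
    have h1 := colorMatrix_mul_self (c := c) hadj
    -- `L` is a sum of three numbers from `{-1, 0, 1}`, so its square cannot be 3.
    have h3 : L * L = 3 := by
      have : L = -(√3 * Γ.colorMatrix c w v) := by linarith
      rw [this]
      calc _ = (√3 * √3) * (Γ.colorMatrix c w v * Γ.colorMatrix c w v) := by ring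
        _ = 3 := by rw [hsq, h1, mul_one]
    rcases hprod a with h | h | h <;> rcases hprod b with h' | h' | h' <;>
      rcases hprod d with h'' | h'' | h'' <;> rw [hL, h, h', h''] at h3 <;> norm_num at h3
  refine ⟨hw, ?_⟩
  rw [colorMatrix_of_not_adj hw] at hM
  linarith

theorem claw_center (hΓ : Γ.FormBounded c) {v a b d w : V} (hc : Γ.IsClaw v a b d)
    (hw : Γ.Adj v w) : w = a ∨ w = b ∨ w = d := by
  by_contra! h
  exact (hΓ.claw_relation hc hw.ne.symm h.1 h.2.1 h.2.2).1 hw.symm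

/-- A single nonzero term in the orthogonality relation cannot cancel. -/
theorem claw_adj (hΓ : Γ.FormBounded c) {v a b d w : V} (hc : Γ.IsClaw v a b d)
    (hv : w ≠ v) (ha : Γ.Adj w a) : Γ.Adj w b ∨ Γ.Adj w d := by
  by_contra! h
  have hb : w ≠ b := by
    rintro rfl
    exact hc.ab ha.symm
  have hd : w ≠ d := by
    rintro rfl
    exact hc.ad ha.symm
  have := (hΓ.claw_relation hc hv ha.ne hb hd).2
  rw [colorMatrix_of_not_adj h.1, colorMatrix_of_not_adj h.2] at this
  simp [colorMatrix_ne_zero ha, colorMatrix_ne_zero hc.va] at this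

/-- Three signs never sum to zero, so exactly two leaves are met and their terms are opposite: the
4-cycle `v a w b` is negative. -/
theorem claw_sign (hΓ : Γ.FormBounded c) {v a b d w : V} (hc : Γ.IsClaw v a b d)
    (hv : w ≠ v) (ha : Γ.Adj w a) (hb : Γ.Adj w b) : ¬ Γ.Adj w d ∧
      Γ.colorMatrix c v a * Γ.colorMatrix c w a = -(Γ.colorMatrix c v b * Γ.colorMatrix c w b) := by
  have hd : w ≠ d := by
    rintro rfl
    exact hc.ad ha.symm
  have h := (hΓ.claw_relation hc hv ha.ne hb.ne hd).2
  have hd' : ¬ Γ.Adj w d := by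
    intro hd
    have h1 := hc.va
    have h2 := hc.vb
    have h3 := hc.vd
    rw [colorMatrix_of_adj ha, colorMatrix_of_adj hb, colorMatrix_of_adj hd, colorMatrix_of_adj h1,
      colorMatrix_of_adj h2, colorMatrix_of_adj h3] at h
    split_ifs at h <;> norm_num at h
  rw [colorMatrix_of_not_adj hd'] at h
  exact ⟨hd', by linarith⟩

/-- If `w` and `w'` are distinct and adjacent, the two triangles on them force `c a = c b`, making
the 4-cycle through `v` and `w` positive. If they are not adjacent, the cycle `a w b w'` is induced
and positive, being the product of two negative ones, so it has eigenvalue `2 > √3`. -/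
theorem claw_unique (hΓ : Γ.FormBounded c) {v a b d w w' : V} (hc : Γ.IsClaw v a b d)
    (hv : w ≠ v) (ha : Γ.Adj w a) (hb : Γ.Adj w b)
    (hv' : w' ≠ v) (ha' : Γ.Adj w' a) (hb' : Γ.Adj w' b) : w = w' := by
  by_contra hne
  have h := (hΓ.claw_sign hc hv ha hb).2
  have h' := (hΓ.claw_sign hc hv' ha' hb').2
  have h1 := hc.va
  have h2 := hc.vb
  by_cases hadj : Γ.Adj w w'
  · have t := hΓ.color_ne_of_triangle hadj ha ha'
    have t' := hΓ.color_ne_of_triangle hadj hb hb'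
    have e : c a = c b := by
      revert t t'
      generalize c w = p
      generalize c w' = q
      generalize c a = r
      generalize c b = s
      revert p q r s
      decide
    rw [colorMatrix_of_adj h1, colorMatrix_of_adj h2, colorMatrix_of_adj ha,
      colorMatrix_of_adj hb, e] at h
    split_ifs at h <;> norm_num at h
  -- The entries are the switching that makes the edges `aw`, `aw'` and `wb` positive; the form then
  -- equals `8`, against the bound `4√3`.
  · have q := hΓ.form_four ha.ne.symm ha'.ne.symm hc.hab hne hb.ne hb'.ne 1 (Γ.colorMatrix c w a)
      (Γ.colorMatrix c w' a) (Γ.colorMatrix c w a * Γ.colorMatrix c w b)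
    have hlt := sqrt_three_lt_two
    rw [colorMatrix_of_not_adj hadj, colorMatrix_of_not_adj hc.ab, Γ.colorMatrix_comm c a w,
      Γ.colorMatrix_comm c a w'] at q
    rw [colorMatrix_of_adj ha, colorMatrix_of_adj hb, colorMatrix_of_adj ha',
      colorMatrix_of_adj hb'] at q
    rw [colorMatrix_of_adj h1, colorMatrix_of_adj h2, colorMatrix_of_adj ha,
      colorMatrix_of_adj hb] at h
    rw [colorMatrix_of_adj h1, colorMatrix_of_adj h2, colorMatrix_of_adj ha',
      colorMatrix_of_adj hb'] at h'
    split_ifs at q h h' <;> linarith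

/-- A vertex at distance two from the centre of a claw, adjacent to a vertex outside the closed
neighbourhood of the leaves, is the centre of a claw. -/
theorem claw_next {v a b d w z : V} (hc : Γ.IsClaw v a b d)
    (ha : Γ.Adj w a) (hb : Γ.Adj w b) (hz : Γ.Adj w z) (hza : ¬ Γ.Adj z a) (hzb : ¬ Γ.Adj z b)
    (hza' : z ≠ a) (hzb' : z ≠ b) : Γ.IsClaw w a b z :=
  ⟨ha, hb, hz, hc.ab, fun h => hza h.symm, fun h => hzb h.symm, hc.hab, hza'.symm, hzb'.symm⟩

/-- In the new claw at `w` with leaves `a`, `b`, `z`, the vertex `w'` meets the leaf `a` but not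
`b`, so it must meet `z`. -/
theorem far_adj (hΓ : Γ.FormBounded c) {v a b d w w' z : V} (hc : Γ.IsClaw v a b d)
    (ha : Γ.Adj w a) (hb : Γ.Adj w b) (hz : Γ.Adj w z) (hza : ¬ Γ.Adj z a)
    (hzb : ¬ Γ.Adj z b) (hza' : z ≠ a) (hzb' : z ≠ b)
    (hw' : w' ≠ v) (ha' : Γ.Adj w' a) (hd' : Γ.Adj w' d) : Γ.Adj w' z := by
  have hb' := (hΓ.claw_sign hc.swap₂₃ hw' ha' hd').1
  have hc' := claw_next hc ha hb hz hza hzb hza' hzb'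
  have hne : w' ≠ w := by
    rintro rfl
    exact hb' hb
  exact (hΓ.claw_adj hc' hne ha').resolve_left hb'

theorem card_independent_le (hno : ∀ v a b d, ¬ Γ.IsClaw v a b d) {v : V} {s : Finset V}
    (hs : ∀ x ∈ s, Γ.Adj v x) (hi : ∀ x ∈ s, ∀ y ∈ s, ¬ Γ.Adj x y) : s.card ≤ 2 := by
  by_contra! h
  obtain ⟨a, b, d, ha, hb, hd, hab, had, hbd⟩ := Finset.two_lt_card_iff.1 h
  exact hno v a b d ⟨hs a ha, hs b hb, hs d hd, hi a ha b hb, hi a ha d hd, hi b hb d hd,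
    hab, had, hbd⟩

theorem comap (hΓ : Γ.FormBounded c) (p : V → Prop) :
    (Γ.comap (Subtype.val : Subtype p → V)).FormBounded (c ∘ Subtype.val) := by
  intro k hk f hf x
  exact hΓ k hk (Subtype.val ∘ f) (Subtype.val_injective.comp hf) x

end FormBounded

/-- The sign of an edge whose endpoints have the given colours. -/
def colorSign (p q : Fin 3) : ℤ := if p = q then 1 else -1

theorem colorMatrix_eq_colorSign {u v : V} (h : Γ.Adj u v) :
    Γ.colorMatrix c u v = (colorSign (c u) (c v) : ℝ) := by
  rw [colorMatrix_of_adj h, colorSign]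
  split_ifs <;> simp

theorem FormBounded.claw_face (hΓ : Γ.FormBounded c) {v a b d w : V} (hc : Γ.IsClaw v a b d)
    (hv : w ≠ v) (ha : Γ.Adj w a) (hb : Γ.Adj w b) :
    colorSign (c v) (c a) * colorSign (c w) (c a) =
      -(colorSign (c v) (c b) * colorSign (c w) (c b)) := by
  have h := (hΓ.claw_sign hc hv ha hb).2
  rw [colorMatrix_eq_colorSign ha, colorMatrix_eq_colorSign hb, colorMatrix_eq_colorSign hc.va,
    colorMatrix_eq_colorSign hc.vb] at h
  exact_mod_cast h

set_option maxRecDepth 100000 in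
/-- The cube with an odd number of negative edges in every face has no valid `3`-colouring. -/
theorem not_cube_coloring : ∀ v a b w₁ : Fin 3,
    colorSign v a * colorSign w₁ a = -(colorSign v b * colorSign w₁ b) →
    ∀ d w₂ : Fin 3, colorSign v a * colorSign w₂ a = -(colorSign v d * colorSign w₂ d) →
    ∀ w₃ : Fin 3, colorSign v b * colorSign w₃ b = -(colorSign v d * colorSign w₃ d) →
    ∀ z : Fin 3, colorSign w₁ a * colorSign w₂ a = -(colorSign w₁ z * colorSign w₂ z) →
      colorSign w₁ b * colorSign w₃ b = -(colorSign w₁ z * colorSign w₃ z) →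
      colorSign w₂ d * colorSign w₃ d = -(colorSign w₂ z * colorSign w₃ z) → False := by
  -- Each hypothesis directly follows the last colour that it mentions, so the search drops a
  -- partial colouring as soon as a face fails.
  decide

end SimpleGraph

/-! ### The components around a claw -/

namespace SimpleGraph

variable {V : Type*} [Fintype V] [DecidableEq V] {Γ : SimpleGraph V} {c : V → Fin 3}

open Classical in
/-- The common neighbours of `a` and `b` other than `v`. -/
noncomputable def otherCommon (Γ : SimpleGraph V) (v a b : V) : Finset V :=
  Finset.univ.filter fun w => w ≠ v ∧ Γ.Adj w a ∧ Γ.Adj w b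

theorem mem_otherCommon {v a b w : V} :
    w ∈ Γ.otherCommon v a b ↔ w ≠ v ∧ Γ.Adj w a ∧ Γ.Adj w b := by
  simp [otherCommon]

/-- The claw together with the vertices at distance two from its centre. -/
noncomputable def clawCore (Γ : SimpleGraph V) (v a b d : V) : Finset V :=
  {v, a, b, d} ∪ (Γ.otherCommon v a b ∪ Γ.otherCommon v a d ∪ Γ.otherCommon v b d)

open Classical in
/-- The neighbours of the core of a claw. -/
noncomputable def clawFar (Γ : SimpleGraph V) (v a b d : V) : Finset V :=
  Finset.univ.filter fun z => z ∉ Γ.clawCore v a b d ∧ ∃ w ∈ Γ.clawCore v a b d, Γ.Adj w z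

theorem mem_clawCore {v a b d w : V} : w ∈ Γ.clawCore v a b d ↔
    w = v ∨ w = a ∨ w = b ∨ w = d ∨
      w ≠ v ∧ (Γ.Adj w a ∧ Γ.Adj w b ∨ Γ.Adj w a ∧ Γ.Adj w d ∨ Γ.Adj w b ∧ Γ.Adj w d) := by
  simp only [clawCore, Finset.mem_union, Finset.mem_insert, Finset.mem_singleton, mem_otherCommon]
  tauto

theorem clawCore_swap₁₂ (Γ : SimpleGraph V) (v a b d : V) :
    Γ.clawCore v b a d = Γ.clawCore v a b d := by
  ext w
  simp only [mem_clawCore]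
  tauto

theorem clawCore_swap₂₃ (Γ : SimpleGraph V) (v a b d : V) :
    Γ.clawCore v a d b = Γ.clawCore v a b d := by
  ext w
  simp only [mem_clawCore]
  tauto

namespace FormBounded

theorem mem_clawCore_of_adj (hΓ : Γ.FormBounded c) {v a b d w : V} (hc : Γ.IsClaw v a b d)
    (h : Γ.Adj w a) : w ∈ Γ.clawCore v a b d := by
  rw [mem_clawCore]
  by_cases hv : w = v
  · exact Or.inl hv
  · rcases hΓ.claw_adj hc hv h with h' | h' <;> tauto

theorem not_adj_of_not_mem_clawCore (hΓ : Γ.FormBounded c) {v a b d z : V}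
    (hc : Γ.IsClaw v a b d) (hz : z ∉ Γ.clawCore v a b d) :
    ¬ Γ.Adj z v ∧ ¬ Γ.Adj z a ∧ ¬ Γ.Adj z b ∧ ¬ Γ.Adj z d := by
  refine ⟨fun h => hz ?_, fun h => hz (hΓ.mem_clawCore_of_adj hc h), fun h => hz ?_,
    fun h => hz ?_⟩
  · rw [mem_clawCore]
    rcases hΓ.claw_center hc h.symm with h | h | h <;> tauto
  · rw [← clawCore_swap₁₂]
    exact hΓ.mem_clawCore_of_adj hc.swap₁₂ h
  · rw [← clawCore_swap₂₃, ← clawCore_swap₁₂]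
    exact hΓ.mem_clawCore_of_adj hc.swap₂₃.swap₁₂ h

/-- Up to the order of its leaves, a claw and a vertex `z` next to its core have the following
configuration. -/
theorem exists_claw_of_far (hΓ : Γ.FormBounded c) {v a b d z : V} (hc : Γ.IsClaw v a b d)
    (hz : z ∈ Γ.clawFar v a b d) : ∃ a' b' d' w, Γ.IsClaw v a' b' d' ∧
      Γ.clawCore v a' b' d' = Γ.clawCore v a b d ∧ w ≠ v ∧ Γ.Adj w a' ∧ Γ.Adj w b' ∧
      Γ.IsClaw w a' b' z := by
  simp only [clawFar, Finset.mem_filter, Finset.mem_univ, true_and] at hz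
  obtain ⟨hz, w, hw, hwz⟩ := hz
  obtain ⟨hzv, hza, hzb, hzd⟩ := hΓ.not_adj_of_not_mem_clawCore hc hz
  have hw' := mem_clawCore.1 hw
  have hne : z ≠ a ∧ z ≠ b ∧ z ≠ d := by
    rw [mem_clawCore] at hz
    tauto
  rcases hw' with rfl | rfl | rfl | rfl | ⟨hwv, h | h | h⟩
  · exact absurd hwz.symm hzv
  · exact absurd hwz.symm hza
  · exact absurd hwz.symm hzb
  · exact absurd hwz.symm hzd
  · exact ⟨a, b, d, w, hc, rfl, hwv, h.1, h.2,
      claw_next hc h.1 h.2 hwz hza hzb hne.1 hne.2.1⟩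
  · exact ⟨a, d, b, w, hc.swap₂₃, clawCore_swap₂₃ .., hwv, h.1, h.2,
      claw_next hc.swap₂₃ h.1 h.2 hwz hza hzd hne.1 hne.2.2⟩
  · exact ⟨b, d, a, w, hc.swap₁₂.swap₂₃, by rw [clawCore_swap₂₃, clawCore_swap₁₂], hwv, h.1, h.2,
      claw_next hc.swap₁₂.swap₂₃ h.1 h.2 hwz hzb hzd hne.2.1 hne.2.2⟩

theorem not_mem_clawCore_of_far {v a b d z : V} (hz : z ∈ Γ.clawFar v a b d) :
    z ∉ Γ.clawCore v a b d := by
  simp only [clawFar, Finset.mem_filter, Finset.mem_univ, true_and] at hz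
  exact hz.1

/-- A vertex next to the core is adjacent to all vertices of the core at distance two from the
centre. -/
theorem far_adj_all (hΓ : Γ.FormBounded c) {v a b d z w : V} (hc : Γ.IsClaw v a b d)
    (hz : z ∈ Γ.clawFar v a b d) (hw : w ∈ Γ.clawCore v a b d) (hwv : w ≠ v) (hwa : w ≠ a)
    (hwb : w ≠ b) (hwd : w ≠ d) : Γ.Adj w z := by
  have hz' := not_mem_clawCore_of_far hz
  obtain ⟨a', b', d', w', hc', hcore, hw'v, ha', hb', hcw⟩ := hΓ.exists_claw_of_far hc hz
  rw [← hcore] at hz'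
  obtain ⟨hzv, hza, hzb, hzd⟩ := hΓ.not_adj_of_not_mem_clawCore hc' hz'
  have hne : z ≠ a' ∧ z ≠ b' ∧ z ≠ d' := by
    rw [mem_clawCore] at hz'
    tauto
  have key : w ≠ v ∧ (Γ.Adj w a' ∧ Γ.Adj w b' ∨ Γ.Adj w a' ∧ Γ.Adj w d' ∨
      Γ.Adj w b' ∧ Γ.Adj w d') := by
    have h3 : w ≠ a' ∧ w ≠ b' ∧ w ≠ d' := by
      have hl : ∀ u, Γ.Adj v u → u = a ∨ u = b ∨ u = d := fun u => hΓ.claw_center hc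
      refine ⟨?_, ?_, ?_⟩ <;> rintro rfl
      · exact (hl _ hc'.va).elim hwa fun h => h.elim hwb hwd
      · exact (hl _ hc'.vb).elim hwa fun h => h.elim hwb hwd
      · exact (hl _ hc'.vd).elim hwa fun h => h.elim hwb hwd
    rw [← hcore, mem_clawCore] at hw
    rcases hw with h | h | h | h | h
    exacts [absurd h hwv, absurd h h3.1, absurd h h3.2.1, absurd h h3.2.2, h]
  rcases key with ⟨-, h | h | h⟩
  · rw [hΓ.claw_unique hc' hwv h.1 h.2 hw'v ha' hb']
    exact hcw.vd
  · exact hΓ.far_adj hc' ha' hb' hcw.vd hza hzb hne.1 hne.2.1 hwv h.1 h.2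
  · exact hΓ.far_adj hc'.swap₁₂ hb' ha' hcw.vd hzb hza hne.2.1 hne.1 hwv h.1 h.2

/-- Each far vertex is adjacent to the same `w`, the centre of a claw with leaves `a'`, `b'`, `z`; a
claw centre has no other neighbours, and `a'`, `b'` lie in the core. -/
theorem card_clawFar_le (hΓ : Γ.FormBounded c) {v a b d : V} (hc : Γ.IsClaw v a b d) :
    (Γ.clawFar v a b d).card ≤ 1 := by
  rw [Finset.card_le_one]
  intro z hz z' hz'
  obtain ⟨a', b', d', w, hc', hcore, hwv, ha', hb', hcw⟩ := hΓ.exists_claw_of_far hc hz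
  have hz'c := not_mem_clawCore_of_far hz'
  have hwz' : Γ.Adj w z' := by
    have hl : ∀ u, Γ.Adj w u → u ∈ Γ.clawCore v a' b' d' → u = a' ∨ u = b' := by
      intro u hu hm
      rcases hΓ.claw_center hcw hu with h | h | h
      · exact Or.inl h
      · exact Or.inr h
      · rw [h, hcore] at hm
        exact absurd hm (not_mem_clawCore_of_far hz)
    have hl' : ∀ u ∈ ({a, b, d} : Finset V), w ≠ u := by
      rintro u hu rfl
      have hvw : Γ.Adj v w := by
        simp only [Finset.mem_insert, Finset.mem_singleton] at hu
        rcases hu with rfl | rfl | rfl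
        · exact hc.va
        · exact hc.vb
        · exact hc.vd
      rcases hl v hvw.symm (by simp [mem_clawCore]) with h | h
      · exact hc'.va.ne h
      · exact hc'.vb.ne h
    refine hΓ.far_adj_all hc hz' ?_ hwv (hl' a (by simp)) (hl' b (by simp)) (hl' d (by simp))
    rw [← hcore, mem_clawCore]
    tauto
  rcases hΓ.claw_center hcw hwz' with h | h | h
  · rw [← hcore, h, mem_clawCore] at hz'c
    tauto
  · rw [← hcore, h, mem_clawCore] at hz'c
    tauto
  · exact h.symm

/-- There is no further layer: a far vertex is a leaf of a claw whose other leaves are leaves of the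
original one, so any neighbour of it other than the centre meets one of these and falls into the
core. -/
theorem claw_closed (hΓ : Γ.FormBounded c) {v a b d u y : V} (hc : Γ.IsClaw v a b d)
    (hu : u ∈ Γ.clawCore v a b d ∪ Γ.clawFar v a b d) (huy : Γ.Adj u y) :
    y ∈ Γ.clawCore v a b d ∪ Γ.clawFar v a b d := by
  rw [Finset.mem_union] at hu ⊢
  by_cases hy : y ∈ Γ.clawCore v a b d
  · exact Or.inl hy
  rcases hu with hu | hu
  · right
    simp only [clawFar, Finset.mem_filter, Finset.mem_univ, true_and]
    exact ⟨hy, u, hu, huy⟩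
  · exfalso
    obtain ⟨a', b', d', w, hc', hcore, hwv, ha', hb', hcw⟩ := hΓ.exists_claw_of_far hc hu
    rw [← hcore] at hy
    obtain ⟨-, hya, hyb, -⟩ := hΓ.not_adj_of_not_mem_clawCore hc' hy
    have hyw : y ≠ w := by
      rintro rfl
      exact hya ha'
    rcases hΓ.claw_adj hcw.swap₂₃.swap₁₂ hyw huy.symm with h | h
    · exact hya h
    · exact hyb h

theorem card_otherCommon_le (hΓ : Γ.FormBounded c) {v a b d : V} (hc : Γ.IsClaw v a b d) :
    (Γ.otherCommon v a b).card ≤ 1 := by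
  rw [Finset.card_le_one]
  intro w hw w' hw'
  rw [mem_otherCommon] at hw hw'
  exact hΓ.claw_unique hc hw.1 hw.2.1 hw.2.2 hw'.1 hw'.2.1 hw'.2.2

/-- A far vertex would complete a cube. The faces at `v` are negative by the original claw, and
those at `z` by the claws centred at `w₁` and `w₂`, contradicting `not_cube_coloring`. -/
theorem clawFar_eq_empty (hΓ : Γ.FormBounded c) {v a b d w₁ w₂ w₃ : V} (hc : Γ.IsClaw v a b d)
    (h₁ : w₁ ∈ Γ.otherCommon v a b) (h₂ : w₂ ∈ Γ.otherCommon v a d)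
    (h₃ : w₃ ∈ Γ.otherCommon v b d) : Γ.clawFar v a b d = ∅ := by
  rw [Finset.eq_empty_iff_forall_notMem]
  intro z hz
  rw [mem_otherCommon] at h₁ h₂ h₃
  have hz' := not_mem_clawCore_of_far hz
  obtain ⟨hzv, hza, hzb, hzd⟩ := hΓ.not_adj_of_not_mem_clawCore hc hz'
  have hne : z ≠ a ∧ z ≠ b ∧ z ≠ d := by
    rw [mem_clawCore] at hz'
    tauto
  have n₁ := (hΓ.claw_sign hc h₁.1 h₁.2.1 h₁.2.2).1
  have n₂ := (hΓ.claw_sign hc.swap₂₃ h₂.1 h₂.2.1 h₂.2.2).1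
  have hv : ∀ w, Γ.Adj w a ∨ Γ.Adj w b → Γ.Adj w a ∨ Γ.Adj w d → w ≠ v → Γ.Adj w z := by
    intro w hw1 hw2 hwv
    have h1 := hc.ab
    have h2 := hc.ad
    have h3 := hc.bd
    have hmem : w ∈ Γ.clawCore v a b d := by
      rcases hw1 with h | h
      · exact hΓ.mem_clawCore_of_adj hc h
      · rw [← clawCore_swap₁₂]
        exact hΓ.mem_clawCore_of_adj hc.swap₁₂ h
    refine hΓ.far_adj_all hc hz hmem hwv ?_ ?_ ?_ <;> rintro rfl
    · rcases hw1 with h | h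
      · exact h.ne rfl
      · exact h1 h
    · rcases hw2 with h | h
      · exact h1 h.symm
      · exact h3 h
    · rcases hw1 with h | h
      · exact h2 h.symm
      · exact h3 h.symm
  have z₁ := hv w₁ (Or.inl h₁.2.1) (Or.inl h₁.2.1) h₁.1
  have z₂ := hv w₂ (Or.inl h₂.2.1) (Or.inl h₂.2.1) h₂.1
  have z₃ := hv w₃ (Or.inr h₃.2.1) (Or.inr h₃.2.2) h₃.1
  have c₁ := claw_next hc h₁.2.1 h₁.2.2 z₁ hza hzb hne.1 hne.2.1
  have c₂ := claw_next hc.swap₂₃ h₂.2.1 h₂.2.2 z₂ hza hzd hne.1 hne.2.2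
  have e12 : w₂ ≠ w₁ := by
    rintro rfl
    exact n₁ h₂.2.2
  have e13 : w₃ ≠ w₁ := by
    rintro rfl
    exact n₁ h₃.2.2
  have e23 : w₃ ≠ w₂ := by
    rintro rfl
    exact n₂ h₃.2.1
  exact not_cube_coloring (c v) (c a) (c b) (c w₁) (hΓ.claw_face hc h₁.1 h₁.2.1 h₁.2.2)
    (c d) (c w₂) (hΓ.claw_face hc.swap₂₃ h₂.1 h₂.2.1 h₂.2.2)
    (c w₃) (hΓ.claw_face hc.swap₁₂.swap₂₃ h₃.1 h₃.2.1 h₃.2.2)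
    (c z) (hΓ.claw_face c₁.swap₂₃ e12 h₂.2.1 z₂)
    (hΓ.claw_face c₁.swap₁₂.swap₂₃ e13 h₃.2.1 z₃)
    (hΓ.claw_face c₂.swap₁₂.swap₂₃ e23 h₃.2.2 z₃)

/-- Besides `v`, each neighbour of `a` is shared with `b` or `d`; with none shared with `b`, at most
one remains. -/
theorem neighbor_card_le_two (hΓ : Γ.FormBounded c) {v a b d : V} (hc : Γ.IsClaw v a b d)
    (h : Γ.otherCommon v a b = ∅) (s : Finset V) (hs : ∀ w ∈ s, Γ.Adj a w) : s.card ≤ 2 := by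
  have hsub : s ⊆ insert v (Γ.otherCommon v a d) := by
    intro w hw
    rw [Finset.mem_insert, mem_otherCommon]
    by_cases hwv : w = v
    · exact Or.inl hwv
    · refine Or.inr ⟨hwv, (hs w hw).symm, ?_⟩
      refine (hΓ.claw_adj hc hwv (hs w hw).symm).resolve_left fun hb => ?_
      have : w ∈ Γ.otherCommon v a b := mem_otherCommon.2 ⟨hwv, (hs w hw).symm, hb⟩
      simp [h] at this
  have := Finset.card_le_card hsub
  have h1 := Finset.card_insert_le v (Γ.otherCommon v a d)
  have h2 := hΓ.card_otherCommon_le hc.swap₂₃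
  omega

open Classical in
/-- A claw lies in a union of components with at most seven vertices, which has exactly seven
vertices if it is cubic. -/
theorem exists_claw_component (hΓ : Γ.FormBounded c) {v a b d : V} (hc : Γ.IsClaw v a b d) :
    ∃ S : Finset V, v ∈ S ∧ (∀ u ∈ S, ∀ w, Γ.Adj u w → w ∈ S) ∧ S.card ≤ 7 ∧
      (S.card = 7 ∨ ∃ u ∈ S, (Finset.univ.filter fun w => Γ.Adj u w).card ≠ 3) := by
  refine ⟨Γ.clawCore v a b d ∪ Γ.clawFar v a b d, by simp [mem_clawCore],
    fun u hu w huw => hΓ.claw_closed hc hu huw, ?_⟩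
  have c1 := hΓ.card_otherCommon_le hc
  have c2 := hΓ.card_otherCommon_le hc.swap₂₃
  have c3 := hΓ.card_otherCommon_le hc.swap₁₂.swap₂₃
  have c4 := hΓ.card_clawFar_le hc
  have u1 := Finset.card_union_le (Γ.clawCore v a b d) (Γ.clawFar v a b d)
  have u2 : (Γ.clawCore v a b d).card ≤ _ := Finset.card_union_le {v, a, b, d}
    (Γ.otherCommon v a b ∪ Γ.otherCommon v a d ∪ Γ.otherCommon v b d)
  have u3 := Finset.card_union_le (Γ.otherCommon v a b ∪ Γ.otherCommon v a d)
    (Γ.otherCommon v b d)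
  have u4 := Finset.card_union_le (Γ.otherCommon v a b) (Γ.otherCommon v a d)
  have u5 : ({v, a, b, d} : Finset V).card ≤ 4 := Finset.card_le_four
  -- If some pair of leaves has no second common neighbour, the count is at most `4 + 2 + 1` and a
  -- leaf of that pair has degree at most 2. Otherwise there is no far vertex and the core has
  -- exactly `4 + 3` vertices.
  rcases (Γ.otherCommon v a b).eq_empty_or_nonempty with e1 | ⟨w₁, h₁⟩
  · refine ⟨by have := Finset.card_eq_zero.2 e1; omega, Or.inr ⟨a, by simp [mem_clawCore], ?_⟩⟩
    have := hΓ.neighbor_card_le_two hc e1 (Finset.univ.filter fun w => Γ.Adj a w) (by simp)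
    omega
  rcases (Γ.otherCommon v a d).eq_empty_or_nonempty with e2 | ⟨w₂, h₂⟩
  · refine ⟨by have := Finset.card_eq_zero.2 e2; omega, Or.inr ⟨a, by simp [mem_clawCore], ?_⟩⟩
    have := hΓ.neighbor_card_le_two hc.swap₂₃ e2 (Finset.univ.filter fun w => Γ.Adj a w) (by simp)
    omega
  rcases (Γ.otherCommon v b d).eq_empty_or_nonempty with e3 | ⟨w₃, h₃⟩
  · refine ⟨by have := Finset.card_eq_zero.2 e3; omega, Or.inr ⟨b, by simp [mem_clawCore], ?_⟩⟩
    have := hΓ.neighbor_card_le_two hc.swap₁₂.swap₂₃ e3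
      (Finset.univ.filter fun w => Γ.Adj b w) (by simp)
    omega
  rw [hΓ.clawFar_eq_empty hc h₁ h₂ h₃, Finset.union_empty]
  have hle : (Γ.clawCore v a b d).card ≤ 7 := by omega
  refine ⟨hle, Or.inl (le_antisymm hle ?_)⟩
  have hsub : ({v, a, b, d, w₁, w₂, w₃} : Finset V) ⊆ Γ.clawCore v a b d := by
    rw [mem_otherCommon] at h₁ h₂ h₃
    intro u hu
    rw [mem_clawCore]
    simp only [Finset.mem_insert, Finset.mem_singleton] at hu
    rcases hu with h | h | h | h | rfl | rfl | rfl <;> tauto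
  refine le_trans (le_of_eq ?_) (Finset.card_le_card hsub)
  rw [mem_otherCommon] at h₁ h₂ h₃
  have n₁ := (hΓ.claw_sign hc h₁.1 h₁.2.1 h₁.2.2).1
  have n₂ := (hΓ.claw_sign hc.swap₂₃ h₂.1 h₂.2.1 h₂.2.2).1
  have hv := hc.va.ne
  have hv2 := hc.vb.ne
  have hv3 := hc.vd.ne
  have g1 := hc.hab
  have g2 := hc.had
  have g3 := hc.hbd
  have e12 : w₁ ≠ w₂ := by
    rintro rfl
    exact n₁ h₂.2.2
  have e13 : w₁ ≠ w₃ := by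
    rintro rfl
    exact n₁ h₃.2.2
  have e23 : w₂ ≠ w₃ := by
    rintro rfl
    exact n₂ h₃.2.1
  have k1 : d ≠ w₁ := by
    rintro rfl
    exact hc.ad h₁.2.1.symm
  have k2 : b ≠ w₂ := by
    rintro rfl
    exact hc.ab h₂.2.1.symm
  have k3 : a ≠ w₃ := by
    rintro rfl
    exact hc.ab h₃.2.1
  simp [hv, hv2, hv3, g1, g2, g3, e12, e13, e23, k1, k2, k3, h₁.1.symm, h₂.1.symm, h₃.1.symm,
    h₁.2.1.ne.symm, h₁.2.2.ne.symm, h₂.2.1.ne.symm, h₂.2.2.ne.symm, h₃.2.1.ne.symm, h₃.2.2.ne.symm]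

end FormBounded

end SimpleGraph

/-! ### The claw-free case -/

namespace SimpleGraph

variable {V : Type*} [Fintype V] {Γ : SimpleGraph V} {c : V → Fin 3}

open Classical in
theorem colorMatrix_mul_self_apply (Γ : SimpleGraph V) (c : V → Fin 3) (v : V) :
    (Γ.colorMatrix c * Γ.colorMatrix c) v v =
      ((Finset.univ.filter fun w => Γ.Adj v w).card : ℝ) := by
  rw [Matrix.mul_apply, Finset.card_filter]
  push_cast
  refine Finset.sum_congr rfl fun w _ => ?_
  rw [Γ.colorMatrix_comm c w v]
  split_ifs with h
  · exact colorMatrix_mul_self h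
  · simp [colorMatrix_of_not_adj h]

-- Fix a colour `k ≠ c v`. Two adjacent neighbours of `v` carry the two colours other than `c v`, so
-- exactly one of them has colour `k`. The neighbours of colour `k` and the others thus form two
-- independent sets, each of size at most 2 without claws.
open Classical in
theorem FormBounded.degree_le_four (hΓ : Γ.FormBounded c) (hno : ∀ v a b d, ¬ Γ.IsClaw v a b d)
    (v : V) : (Finset.univ.filter fun w => Γ.Adj v w).card ≤ 4 := by
  obtain ⟨k, hk⟩ : ∃ k : Fin 3, k ≠ c v := exists_ne (c v)
  rw [← Finset.card_filter_add_card_filter_not (s := Finset.univ.filter fun w => Γ.Adj v w)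
    (fun w => c w = k)]
  have h1 : ((Finset.univ.filter fun w => Γ.Adj v w).filter fun w => c w = k).card ≤ 2 := by
    refine FormBounded.card_independent_le hno (v := v) (by simp +contextual) ?_
    simp only [Finset.mem_filter, Finset.mem_univ, true_and]
    rintro x ⟨hx, hxk⟩ y ⟨hy, hyk⟩ hxy
    exact (hΓ.color_ne_of_triangle hx hy hxy).2.2 (hxk.trans hyk.symm)
  have h2 : ((Finset.univ.filter fun w => Γ.Adj v w).filter fun w => ¬ c w = k).card ≤ 2 := by
    refine FormBounded.card_independent_le hno (v := v) (by simp +contextual) ?_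
    simp only [Finset.mem_filter, Finset.mem_univ, true_and]
    rintro x ⟨hx, hxk⟩ y ⟨hy, hyk⟩ hxy
    have h := hΓ.color_ne_of_triangle hx hy hxy
    clear h1
    revert hk hxk hyk h
    generalize c v = p
    generalize c x = q
    generalize c y = r
    revert k p q r
    decide
  omega

variable [DecidableEq V]

theorem rootMultiplicity_colorMatrix_neg (Γ : SimpleGraph V) (c : V → Fin 3) :
    (Γ.colorMatrix c).charpoly.rootMultiplicity (-√3) =
      (Γ.colorMatrix c).charpoly.rootMultiplicity (√3) := by
  classical
  have h : Γ.colorMatrix c = (Matrix.of fun u v =>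
      if Γ.Adj u v then if c u = c v then (1 : ℚ) else -1 else 0).map (algebraMap ℚ ℝ) := by
    ext u v
    simp only [colorMatrix, Matrix.of_apply, Matrix.map_apply]
    split_ifs <;> simp
  rw [h, Matrix.charpoly_map]
  exact Polynomial.rootMultiplicity_neg_sqrt_three _

namespace FormBounded

open Classical in
/-- The diagonal of the cube of the matrix counts the edges in a neighbourhood. -/
theorem cube_apply (hΓ : Γ.FormBounded c) (v : V) :
    (Γ.colorMatrix c ^ 3) v v = -∑ x ∈ Finset.univ.filter (fun w => Γ.Adj v w),
      ∑ y ∈ Finset.univ.filter (fun w => Γ.Adj v w), if Γ.Adj x y then (1 : ℝ) else 0 := by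
  rw [pow_succ', pow_two, Matrix.mul_apply, Finset.sum_filter, ← Finset.sum_neg_distrib]
  refine Finset.sum_congr rfl fun x _ => ?_
  by_cases hx : Γ.Adj v x
  · rw [if_pos hx, Matrix.mul_apply, Finset.mul_sum, Finset.sum_filter, ← Finset.sum_neg_distrib]
    refine Finset.sum_congr rfl fun y _ => ?_
    by_cases hy : Γ.Adj v y
    · by_cases hxy : Γ.Adj x y
      · have h := hΓ.color_ne_of_triangle hx hy hxy
        rw [Γ.colorMatrix_comm c y v, colorMatrix_of_adj hx, colorMatrix_of_adj hy,
          colorMatrix_of_adj hxy]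
        simp [h.1, h.2.1, h.2.2, hxy, hy]
      · simp [colorMatrix_of_not_adj hxy, hxy]
    · rw [Γ.colorMatrix_comm c y v, colorMatrix_of_not_adj hy]
      simp [hy]
  · simp [colorMatrix_of_not_adj hx, hx]

-- The sum counts ordered pairs. With no independent triple, a neighbourhood of size 3 has at least
-- one edge and one of size 4 at least two, which is what the linear bound `2d - 4` records.
open Classical in
theorem edges_in_neighborhood (hΓ : Γ.FormBounded c) (hno : ∀ v a b d, ¬ Γ.IsClaw v a b d)
    (v : V) : 2 * ((Finset.univ.filter fun w => Γ.Adj v w).card : ℝ) - 4 ≤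
      ∑ x ∈ Finset.univ.filter (fun w => Γ.Adj v w),
        ∑ y ∈ Finset.univ.filter (fun w => Γ.Adj v w), if Γ.Adj x y then (1 : ℝ) else 0 := by
  have hle := hΓ.degree_le_four hno v
  have hmem : ∀ x ∈ Finset.univ.filter (fun w => Γ.Adj v w), Γ.Adj v x := by simp
  generalize Finset.univ.filter (fun w => Γ.Adj v w) = N at hle hmem ⊢
  have hnn : 0 ≤ ∑ x ∈ N, ∑ y ∈ N, if Γ.Adj x y then (1 : ℝ) else 0 :=
    Finset.sum_nonneg fun x _ => Finset.sum_nonneg fun y _ => by split_ifs <;> norm_num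
  have htri : ∀ x ∈ N, ∀ y ∈ N, ∀ z ∈ N, x ≠ y → x ≠ z → y ≠ z →
      Γ.Adj x y ∨ Γ.Adj x z ∨ Γ.Adj y z := by
    intro x hx y hy z hz hxy hxz hyz
    by_contra! h
    exact hno v x y z ⟨hmem x hx, hmem y hy, hmem z hz, h.1, h.2.1, h.2.2, hxy, hxz, hyz⟩
  obtain h2 | h3 | h4 : N.card ≤ 2 ∨ N.card = 3 ∨ N.card = 4 := by omega
  · have : (N.card : ℝ) ≤ 2 := by exact_mod_cast h2
    linarith
  · obtain ⟨x, y, z, hxy, hxz, hyz, rfl⟩ := Finset.card_eq_three.1 h3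
    have h := htri x (by simp) y (by simp) z (by simp) hxy hxz hyz
    rw [h3]
    simp only [Finset.sum_insert, Finset.mem_insert, Finset.mem_singleton, hxy, hxz, hyz, or_self,
      not_false_eq_true, Finset.sum_singleton, Γ.adj_comm y x, Γ.adj_comm z x,
      Γ.adj_comm z y]
    by_cases a1 : Γ.Adj x y <;> by_cases a2 : Γ.Adj x z <;> by_cases a3 : Γ.Adj y z <;>
      simp only [a1, a2, a3, or_self] at h <;> simp [a1, a2, a3] <;> norm_num
  · obtain ⟨x, y, z, w, hxy, hxz, hxw, hyz, hyw, hzw, rfl⟩ := Finset.card_eq_four.1 h4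
    have h₁ := htri x (by simp) y (by simp) z (by simp) hxy hxz hyz
    have h₂ := htri x (by simp) y (by simp) w (by simp) hxy hxw hyw
    have h₃ := htri x (by simp) z (by simp) w (by simp) hxz hxw hzw
    have h₄ := htri y (by simp) z (by simp) w (by simp) hyz hyw hzw
    rw [h4]
    simp only [Finset.sum_insert, Finset.mem_insert, Finset.mem_singleton, hxy, hxz, hyz, hxw, hyw,
      hzw, or_self, not_false_eq_true, Finset.sum_singleton, Γ.adj_comm y x,
      Γ.adj_comm z x, Γ.adj_comm z y, Γ.adj_comm w x, Γ.adj_comm w y, Γ.adj_comm w z]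
    by_cases a1 : Γ.Adj x y <;> by_cases a2 : Γ.Adj x z <;> by_cases a3 : Γ.Adj x w <;>
      by_cases a4 : Γ.Adj y z <;> by_cases a5 : Γ.Adj y w <;> by_cases a6 : Γ.Adj z w <;>
      simp only [a1, a2, a3, a4, a5, a6, or_self, or_false, or_true] at h₁ h₂ h₃ h₄ <;>
      simp [a1, a2, a3, a4, a5, a6] <;> norm_num

theorem neg_four_le_eigenvalues (hΓ : Γ.FormBounded c) (hno : ∀ v a b d, ¬ Γ.IsClaw v a b d)
    (i : V) : -4 ≤ (Γ.isHermitian_colorMatrix c).eigenvalues i := by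
  classical
  have hs := (Γ.isHermitian_colorMatrix c).eigenvalues_mem_spectrum_real i
  rw [← Matrix.spectrum_toLin', ← Module.End.hasEigenvalue_iff_mem_spectrum] at hs
  -- Gershgorin: the diagonal is zero and the absolute row sum is the degree, at most 4.
  obtain ⟨k, hk⟩ := eigenvalue_mem_ball hs
  rw [colorMatrix_self, mem_closedBall_zero_iff, Real.norm_eq_abs] at hk
  have hsum : ∑ j ∈ Finset.univ.erase k, ‖Γ.colorMatrix c k j‖ ≤ 4 := by
    calc _ ≤ ∑ j, ‖Γ.colorMatrix c k j‖ :=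
          Finset.sum_le_sum_of_subset_of_nonneg (Finset.erase_subset _ _)
            fun _ _ _ => norm_nonneg _
      _ = ((Finset.univ.filter fun w => Γ.Adj k w).card : ℝ) := by
          rw [Finset.card_filter]
          push_cast
          refine Finset.sum_congr rfl fun j _ => ?_
          by_cases h : Γ.Adj k j
          · rw [colorMatrix_of_adj h, if_pos h]
            split_ifs <;> simp
          · simp [colorMatrix_of_not_adj h, h]
      _ ≤ 4 := by exact_mod_cast hΓ.degree_le_four hno k
  exact (abs_le.1 (hk.trans hsum)).1

open Polynomial in
theorem five_mul_le_of_claw_free (hΓ : Γ.FormBounded c) (hno : ∀ v a b d, ¬ Γ.IsClaw v a b d) :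
    5 * (Γ.colorMatrix c).charpoly.rootMultiplicity (√3) ≤ 2 * Fintype.card V := by
  classical
  have hA := Γ.isHermitian_colorMatrix c
  -- This is `(t + 4)(t - 1)²`, nonnegative on `[-4, ∞)`. Its coefficient 2 balances the bound `2d -
  -- 4` on the cube, so each diagonal entry is at most 8, whatever the degree; the values at `±√3`
  -- sum to 20.
  have h := hA.rootMultiplicity_mul_le_trace (X ^ 3 + C 2 * X ^ 2 - C 7 * X + C 4) (fun i => by
    have h4 := hΓ.neg_four_le_eigenvalues hno i
    simp only [eval_add, eval_sub, eval_mul, eval_pow, eval_X, eval_C]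
    set t := (Γ.isHermitian_colorMatrix c).eigenvalues i
    have : t ^ 3 + 2 * t ^ 2 - 7 * t + 4 = (t + 4) * (t - 1) ^ 2 := by ring
    rw [this]
    exact mul_nonneg (by linarith) (sq_nonneg _)) (Γ.rootMultiplicity_colorMatrix_neg c)
  have htr : (aeval (Γ.colorMatrix c) (X ^ 3 + C 2 * X ^ 2 - C 7 * X + C 4 : ℝ[X])).trace ≤
      8 * Fintype.card V := by
    have : (8 * Fintype.card V : ℝ) = ∑ _v : V, 8 := by simp [mul_comm]
    rw [this, Matrix.trace]
    refine Finset.sum_le_sum fun v _ => ?_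
    have e1 := hΓ.cube_apply v
    have e2 := Γ.colorMatrix_mul_self_apply c v
    have e3 := hΓ.edges_in_neighborhood hno v
    rw [← pow_two] at e2
    have e4 : (aeval (Γ.colorMatrix c) (X ^ 3 + C 2 * X ^ 2 - C 7 * X + C 4 : ℝ[X])) v v =
        (Γ.colorMatrix c ^ 3) v v + 2 * (Γ.colorMatrix c ^ 2) v v + 4 := by
      simp [Matrix.algebraMap_eq_diagonal, Matrix.diagonal_mul]
    rw [Matrix.diag_apply, e4, e1, e2]
    linarith
  have hsq : (√3 : ℝ) ^ 2 = 3 := Real.sq_sqrt (by norm_num)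
  have hev : (X ^ 3 + C 2 * X ^ 2 - C 7 * X + C 4 : ℝ[X]).eval (√3) +
      (X ^ 3 + C 2 * X ^ 2 - C 7 * X + C 4 : ℝ[X]).eval (-√3) = 20 := by
    simp only [eval_add, eval_sub, eval_mul, eval_pow, eval_X, eval_C]
    nlinarith
  rw [hev] at h
  have h' : (20 * (Γ.colorMatrix c).charpoly.rootMultiplicity (√3) : ℝ) ≤ 8 * Fintype.card V := by
    linarith
  have h'' : 20 * (Γ.colorMatrix c).charpoly.rootMultiplicity (√3) ≤ 8 * Fintype.card V := by
    exact_mod_cast h'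
  omega

end FormBounded

/-! ### Splitting off components and induction -/

theorem rootMultiplicity_colorMatrix_split (Γ : SimpleGraph V) (c : V → Fin 3) (S : Finset V)
    (hS : ∀ u ∈ S, ∀ w, Γ.Adj u w → w ∈ S) (x : ℝ) :
    (Γ.colorMatrix c).charpoly.rootMultiplicity x =
      ((Γ.comap (Subtype.val : {v // v ∈ S} → V)).colorMatrix
        (c ∘ Subtype.val)).charpoly.rootMultiplicity x +
      ((Γ.comap (Subtype.val : {v // v ∉ S} → V)).colorMatrix
        (c ∘ Subtype.val)).charpoly.rootMultiplicity x := by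
  classical
  rw [← Polynomial.rootMultiplicity_mul
    (mul_ne_zero (Matrix.charpoly_monic _).ne_zero (Matrix.charpoly_monic _).ne_zero)]
  congr 1
  rw [← Matrix.charpoly_reindex (Equiv.sumCompl (· ∈ S)).symm (Γ.colorMatrix c),
    ← Matrix.charpoly_fromBlocks_zero₁₂ (M₂₁ := 0)]
  congr 1
  ext (u | u) (w | w)
  · simp [colorMatrix]
  · simp only [Matrix.reindex_apply, Equiv.symm_symm, Matrix.submatrix_apply,
      Equiv.sumCompl_apply_inl, Equiv.sumCompl_apply_inr, Matrix.fromBlocks_apply₁₂]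
    exact colorMatrix_of_not_adj fun h => w.2 (hS u u.2 w h)
  · simp only [Matrix.reindex_apply, Equiv.symm_symm, Matrix.submatrix_apply,
      Equiv.sumCompl_apply_inl, Equiv.sumCompl_apply_inr, Matrix.fromBlocks_apply₂₁]
    exact colorMatrix_of_not_adj fun h => u.2 (hS w w.2 u h.symm)
  · simp [colorMatrix]

theorem two_mul_rootMultiplicity_le (Γ : SimpleGraph V) (c : V → Fin 3) :
    2 * (Γ.colorMatrix c).charpoly.rootMultiplicity (√3) ≤ Fintype.card V := by
  have h := (Γ.isHermitian_colorMatrix c).rootMultiplicity_mul_le_trace 1 (by simp)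
    (Γ.rootMultiplicity_colorMatrix_neg c)
  norm_num at h
  have : (2 * (Γ.colorMatrix c).charpoly.rootMultiplicity (√3) : ℝ) ≤ Fintype.card V := by linarith
  exact_mod_cast this

/-- Multiplicities add over unions of components, so it suffices to remove a set around a claw whose
own ratio is at most `3/7`, until no claw is left. -/
theorem FormBounded.seven_mul_le : ∀ (n : ℕ) {V : Type*} [Fintype V] [DecidableEq V]
    {Γ : SimpleGraph V} {c : V → Fin 3}, Γ.FormBounded c → Fintype.card V = n →
    7 * (Γ.colorMatrix c).charpoly.rootMultiplicity (√3) ≤ 3 * n := by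
  intro n
  induction n using Nat.strong_induction_on with
  | _ n ih =>
  intro V _ _ Γ c hΓ hn
  classical
  by_cases hno : ∀ v a b d, ¬ Γ.IsClaw v a b d
  · have := hΓ.five_mul_le_of_claw_free hno
    omega
  push Not at hno
  obtain ⟨v, a, b, d, hc⟩ := hno
  obtain ⟨S, hv, hS, h7, hdeg⟩ := hΓ.exists_claw_component hc
  rw [Γ.rootMultiplicity_colorMatrix_split c S hS]
  have hcard : Fintype.card {v // v ∈ S} = S.card := Fintype.card_coe S
  have hcompl : Fintype.card {v // v ∉ S} = n - S.card := by
    rw [Fintype.card_subtype_compl, hcard, hn]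
  have hSn : S.card ≤ n := hn ▸ Finset.card_le_univ S
  have hpos : 0 < S.card := Finset.card_pos.2 ⟨v, hv⟩
  have h1 := ih (n - S.card) (by omega) (hΓ.comap (· ∉ S)) hcompl
  have h2 := (Γ.comap (Subtype.val : {v // v ∈ S} → V)).two_mul_rootMultiplicity_le
    (c ∘ Subtype.val)
  rw [hcard] at h2
  rcases hdeg with hdeg | ⟨u, hu, hdeg⟩
  · omega
  -- The diagonal of the squared matrix is the degree, and `S` is closed under adjacency, so `u`
  -- keeps its degree in `S`. Then `2m < s ≤ 7` yields `7m ≤ 3s` in integers.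
  have h3 := ((Γ.comap (Subtype.val : {v // v ∈ S} → V)).isHermitian_colorMatrix
    (c ∘ Subtype.val)).two_mul_rootMultiplicity_lt
    (rootMultiplicity_colorMatrix_neg _ _) (v := ⟨u, hu⟩) (by
      rw [colorMatrix_mul_self_apply]
      have : (Finset.univ.filter fun w => (Γ.comap (Subtype.val : {v // v ∈ S} → V)).Adj
          ⟨u, hu⟩ w).card = (Finset.univ.filter fun w => Γ.Adj u w).card := by
        refine Finset.card_bij (fun w _ => w.1) (by simp) (fun _ _ _ _ h => Subtype.ext h) ?_
        intro w hw
        have hw' : Γ.Adj u w := by simpa using hw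
        exact ⟨⟨w, hS u hu w hw'⟩, by simpa using hw', rfl⟩
      intro h
      apply hdeg
      rw [← this]
      convert (Nat.cast_injective (R := ℝ) (by exact_mod_cast h)))
  rw [hcard] at h3
  omega

end SimpleGraph

/-! ### Back to signed graphs -/

namespace SignedGraph

variable {V : Type*}

theorem exists_coloring (G : SignedGraph V) (h : G.chromaticNumber ≤ 3) :
    ∃ c : V → Fin 3, G.IsValidColoring c := by
  by_contra hno
  have h4 : (4 : ℕ∞) ≤ G.chromaticNumber := by
    refine le_iInf₂ fun t ht => ?_
    obtain ⟨c, hc⟩ := ht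
    by_contra! hlt
    have hlt' : t < 4 := by exact_mod_cast hlt
    refine hno ⟨fun v => Fin.castLE (by omega) (c v), fun u v huv he => hc.1 u v huv ?_,
      fun u v huv => ?_⟩
    · exact Fin.castLE_injective _ he
    · exact congrArg _ (hc.2 u v huv)
  exact absurd (h4.trans h) (by decide)

theorem adjMatrix_eq_colorMatrix (G : SignedGraph V) {c : V → Fin 3} (hc : G.IsValidColoring c) :
    G.adjMatrix = (G.pos ⊔ G.neg).colorMatrix c := by
  ext u v
  simp only [adjMatrix, SimpleGraph.colorMatrix, Matrix.of_apply, SimpleGraph.sup_adj]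
  by_cases hp : G.pos.Adj u v
  · simp [hp, hc.2 u v hp]
  · by_cases hn : G.neg.Adj u v
    · simp [hp, hn, hc.1 u v hn]
    · simp [hp, hn]

/-- The signed graph induced along a map. -/
def comap {W : Type*} (f : W → V) (G : SignedGraph V) : SignedGraph W where
  pos := G.pos.comap f
  neg := G.neg.comap f
  disj := by
    rw [SimpleGraph.disjoint_left]
    intro a b h
    exact SimpleGraph.disjoint_left.1 G.disj (f a) (f b) h

/-- An induced subgraph on at most five vertices is not in the family, so its top eigenvalue, and
hence its Rayleigh quotient, is at most `√3`. -/
theorem formBounded (G : SignedGraph V) (hG : G.IsFree (smallFamily 5 (√3))) {c : V → Fin 3}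
    (hc : G.IsValidColoring c) : (G.pos ⊔ G.neg).FormBounded c := by
  intro k hk f hf x
  rw [← G.adjMatrix_eq_colorMatrix hc]
  have hle : ∀ i, (G.comap f).isHermitian_adjMatrix.eigenvalues i ≤ √3 := by
    intro i
    by_contra! hlt
    refine hG ⟨k, G.comap f⟩ ⟨hk, ?_⟩ ⟨⟨f, hf⟩, fun a b => ⟨Iff.rfl, Iff.rfl⟩⟩
    have hpos : 0 < Fintype.card (Fin k) := Fintype.card_pos_iff.2 ⟨i⟩
    refine ⟨hpos, hlt.trans_le ?_⟩
    exact (G.comap f).isHermitian_adjMatrix.eigenvalues₀_antitone (Nat.zero_le _)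
  have h := (G.comap f).isHermitian_adjMatrix.dotProduct_mulVec_le hle x
  have e : ∀ i j, (G.comap f).adjMatrix i j = G.adjMatrix (f i) (f j) := fun i j => rfl
  simp only [dotProduct, Matrix.mulVec, e, Finset.mul_sum] at h
  simpa only [Finset.mul_sum, pow_two, mul_assoc] using h

theorem mult_eq_rootMultiplicity [Fintype V] [DecidableEq V] (G : SignedGraph V) (x : ℝ) :
    G.mult x = G.adjMatrix.charpoly.rootMultiplicity x := by
  classical
  rw [← G.isHermitian_adjMatrix.card_eigenvalues_eq, mult, Nat.card_eq_fintype_card,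
    Fintype.card_subtype]
  refine Finset.card_equiv (Fintype.equivOfCardEq (Fintype.card_fin _)) fun i => ?_
  rw [Finset.mem_filter, Finset.mem_filter]
  simp only [Finset.mem_univ, true_and, eigenvalue, Matrix.IsHermitian.eigenvalues,
    Equiv.symm_apply_apply]

theorem seven_mul_mult_le [Fintype V] [DecidableEq V] (G : SignedGraph V)
    (hG : G.IsFree (smallFamily 5 (√3))) (hχ : G.chromaticNumber ≤ 3) :
    7 * G.mult (√3) ≤ 3 * Fintype.card V := by
  obtain ⟨c, hc⟩ := G.exists_coloring hχ
  rw [mult_eq_rootMultiplicity, G.adjMatrix_eq_colorMatrix hc]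
  exact SimpleGraph.FormBounded.seven_mul_le _ (G.formBounded hG hc) rfl

instance finite [Finite V] : Finite (SignedGraph V) :=
  Finite.of_injective (fun G : SignedGraph V => (G.pos, G.neg)) fun _ _ h =>
    SignedGraph.ext (congrArg Prod.fst h) (congrArg Prod.snd h)

theorem finite_smallFamily (k : ℕ) (x : ℝ) : (smallFamily k x).Finite := by
  refine (Set.finite_range fun H : Σ n : Fin (k + 1), SignedGraph (Fin n) =>
    (⟨H.1, H.2⟩ : Σ n : ℕ, SignedGraph (Fin n))).subset ?_
  rintro ⟨n, H⟩ ⟨hn, -⟩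
  exact ⟨⟨⟨n, Nat.lt_succ_of_le hn⟩, H⟩, rfl⟩

end SignedGraph

theorem theorem5p1 :
    (SignedGraph.smallFamily 5 (Real.sqrt 3)).Finite ∧
    (∀ H ∈ SignedGraph.smallFamily 5 (Real.sqrt 3), H.2.TopEigenvalueGt (Real.sqrt 3)) ∧
    (∀ (V : Type*) [Fintype V] [DecidableEq V] (G : SignedGraph V),
      G.IsFree (SignedGraph.smallFamily 5 (Real.sqrt 3)) → G.chromaticNumber ≤ 3 →
        (G.mult (Real.sqrt 3) : ℝ) ≤ 3 * (Fintype.card V : ℝ) / 7) ∧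
    (∀ N : ℕ,
      (SignedGraph.maxMult 3 (SignedGraph.smallFamily 5 (Real.sqrt 3)) (Real.sqrt 3) N : ℝ) ≤
        3 * (N : ℝ) / 7) := by
  refine ⟨SignedGraph.finite_smallFamily _ _, fun H hH => hH.2, fun V _ _ G hG hχ => ?_,
    fun N => ?_⟩
  · have h : (7 * G.mult (√3) : ℝ) ≤ 3 * Fintype.card V := by
      exact_mod_cast G.seven_mul_mult_le hG hχ
    linarith
  · rcases (SignedGraph.multSet 3 (SignedGraph.smallFamily 5 (√3)) (√3) N).eq_empty_or_nonempty
      with he | hne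
    -- The supremum of the empty set in `ℕ` is 0, so nonemptiness need not be proved.
    · rw [SignedGraph.maxMult, he, csSup_empty, bot_eq_zero, Nat.cast_zero]
      positivity
    · obtain ⟨n, hn, G, hG, hχ, -, hm⟩ := (SignedGraph.isGreatest_maxMult _ _ _ _ hne).1
      have h := G.seven_mul_mult_le hG hχ
      rw [hm, Fintype.card_fin] at h
      have h' : 7 * SignedGraph.maxMult 3 (SignedGraph.smallFamily 5 (√3)) (√3) N ≤ 3 * N := by
        omega
      have h'' : (7 * SignedGraph.maxMult 3 (SignedGraph.smallFamily 5 (√3)) (√3) N : ℝ) ≤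
          3 * N := by exact_mod_cast h'
      linarith
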